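/- Let $\mathcal A(\mathbb R)$ be the set of proper, lower semicontinuous, convex functions $f:\mathbb R\to\mathbb R\cup\{+\infty\}$ (proper: not identically $+\infty$). For $N\ge 2$ put $c(x_1,\dots,x_N)=\sum_{1\le i<j\le N}x_ix_j$ and, for $f_1,\dots,f_N:\mathbb R\to\mathbb R\cup\{+\infty\}$ and $1\le i\le N$, define the $c$-conjugate of the functions $f_j$, $j\ne i$, by $$\Big(\bigoplus_{j\ne i}f_j\Big)^{c}(x_i)=\sup_{x_j\in\mathbb R,\ j\ne i}\Big(c(x_1,\dots,x_N)-\sum_{j\ne i}f_j(x_j)\Big),\qquad x_i\in\mathbb R.$$ **Theorem.** $\mathcal A(\mathbb R)$ is cyclically involutive; that is, for every $N\ge 2$ and all $f_1,\dots,f_N\in\mathcal A(\mathbb R)$: if $$f_i(x_i)=\Big(\bigoplus_{j\ne i}f_j\Big)^{c}(x_i)\quad\text{for all } x_i\in\mathbb R \text{ and every } i=2,\dots,N,$$ then the same identity holds for $i=1$, i.e. $f_1=\big(\bigoplus_{j\ne 1}f_j\big)^{c}$ on $\mathbb R$, so that $(f_1,\dots,f_N)$ is a $c$-conjugate tuple.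 -/

import Mathlib

section CyclicInvolutivity

variable {H : Type*} [NormedAddCommGroup H] [InnerProductSpace ℝ H]

/-- An extended-real-valued function is proper if it never takes the value `-∞`
and is not identically `+∞`. -/
def IsProper {X : Type*} (f : X → EReal) : Prop :=
  (∀ x, f x ≠ ⊥) ∧ ∃ x, f x ≠ ⊤

/-- The class `𝒜(H)` of proper, lower semicontinuous, convex functions `H → ℝ ∪ {+∞}`.
For proper functions no indeterminate sum occurs in the convexity inequality
(and `0 * ⊤ = 0` in `EReal`, so that it is trivial for `a = 0` and for `b = 0`). -/
def properLscConvex (H : Type*) [NormedAddCommGroup H] [InnerProductSpace ℝ H] :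
    Set (H → EReal) :=
  {f | IsProper f ∧ LowerSemicontinuous f ∧
    ∀ (x y : H) (a b : ℝ), 0 ≤ a → 0 ≤ b → a + b = 1 →
      f (a • x + b • y) ≤ (a : EReal) * f x + (b : EReal) * f y}

/-- The cost `c(x₁, …, x_N) = ∑_{i < j} ⟨x_i, x_j⟩`. -/
def cost {N : ℕ} (x : Fin N → H) : ℝ :=
  ∑ i : Fin N, ∑ j ∈ Finset.Ioi i, inner ℝ (x i) (x j)

/-- The `c`-conjugate `(⨁_{j ≠ i} f_j)^c` at `z`: the supremum of
`c(x) - ∑_{j ≠ i} f_j(x_j)` over all tuples `x` whose `i`-th entry is `z`. -/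
noncomputable def cConj {N : ℕ} (f : Fin N → H → EReal) (i : Fin N) (z : H) : EReal :=
  ⨆ (x : Fin N → H) (_ : x i = z),
    ((cost x : EReal) - ∑ j ∈ Finset.univ.erase i, f j (x j))

/-- `(f_1, …, f_N)` is a `c`-conjugate tuple of proper functions. -/
def IsCConjugateTuple {N : ℕ} (f : Fin N → H → EReal) : Prop :=
  (∀ i, IsProper (f i)) ∧ ∀ i z, f i z = cConj f i z

/-- `Ω` is `N`-cyclically involutive. The functions `f_1, …, f_N` are indexed by `Fin N`, so that
`f_1` is the one whose index has value `0`. -/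
def IsNCyclicallyInvolutive (N : ℕ) (Ω : Set (H → EReal)) : Prop :=
  ∀ f : Fin N → H → EReal, (∀ i, f i ∈ Ω) →
    (∀ i : Fin N, (i : ℕ) ≠ 0 → ∀ z, f i z = cConj f i z) →
    IsCConjugateTuple f

/-- `Ω` is cyclically involutive: it is `N`-cyclically involutive for every `N ≥ 2`. -/
def IsCyclicallyInvolutive (Ω : Set (H → EReal)) : Prop :=
  ∀ N : ℕ, 2 ≤ N → IsNCyclicallyInvolutive N Ω

end CyclicInvolutivity

/-- A continuous nonnegative function on `ℝ` that is convex on every compact interval on which it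
is positive is convex. -/
lemma convexOn_univ_of_convexOn_Icc_of_pos {D : ℝ → ℝ} (hD : Continuous D) (h0 : ∀ x, 0 ≤ D x)
    (h : ∀ a b, a < b → (∀ x ∈ Set.Icc a b, 0 < D x) → ConvexOn ℝ (Set.Icc a b) D) :
    ConvexOn ℝ Set.univ D := by
  refine LinearOrder.convexOn_of_lt convex_univ ?_
  intro a _ b _ hab t s ht hs hts
  by_contra! hlt
  simp only [smul_eq_mul] at hlt
  set c := t * a + s * b with hc
  have hba : 0 < b - a := sub_pos.2 hab
  set m := (D b - D a) / (b - a) with hm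
  have hmb : m * (b - a) = D b - D a := by rw [hm]; field_simp
  obtain rfl : t = 1 - s := by linarith
  set M := D c - ((1 - s) * D a + s * D b) with hM
  have hMpos : 0 < M := by linarith
  have hcl : D a + m * (c - a) = (1 - s) * D a + s * D b := by
    have : c - a = s * (b - a) := by rw [hc]; ring
    rw [this]; linear_combination s * hmb
  set η := M / (2 * (b - a) ^ 2) with hη
  have hηpos : 0 < η := by positivity
  have hηM : η * (b - a) ^ 2 = M / 2 := by rw [hη]; field_simp
  have hca : a < c := by rw [hc]; nlinarith
  have hcb : c < b := by rw [hc]; nlinarith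
  let E : ℝ → ℝ := fun x => D x - (D a + m * (x - a)) + η * (x - c) ^ 2
  have hE : Continuous E := by fun_prop
  obtain ⟨x, hx, hmax⟩ := isCompact_Icc.exists_isMaxOn (Set.nonempty_Icc.2 hab.le) hE.continuousOn
  have hmax' : ∀ y ∈ Set.Icc a b, E y ≤ E x := fun y hy => hmax hy
  have hEc : E c = M := by simp only [E, hM]; linarith
  have hMx : M ≤ E x := hEc ▸ hmax' c ⟨hca.le, hcb.le⟩
  have hsmall : ∀ y ∈ Set.Icc a b, η * (y - c) ^ 2 ≤ M / 2 := by
    intro y hy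
    rw [← hηM]
    refine mul_le_mul_of_nonneg_left ?_ hηpos.le
    exact sq_le_sq' (by linarith [hy.1, hy.2]) (by linarith [hy.1, hy.2])
  have hl0 : 0 ≤ D a + m * (x - a) := by
    have h1 : (b - a) * (D a + m * (x - a)) = (b - x) * D a + (x - a) * D b := by
      linear_combination (x - a) * hmb
    have h2 : 0 ≤ (b - a) * (D a + m * (x - a)) := by
      rw [h1]
      exact add_nonneg (mul_nonneg (by linarith [hx.2]) (h0 a))
        (mul_nonneg (by linarith [hx.1]) (h0 b))
    exact nonneg_of_mul_nonneg_right h2 hba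
  have hxa : x ≠ a := by
    rintro rfl
    have := hsmall x hx
    simp only [E] at hMx
    linarith
  have hxb : x ≠ b := by
    rintro rfl
    have := hsmall x hx
    simp only [E] at hMx
    linarith
  have hDx : 0 < D x := by
    have := hsmall x hx
    simp only [E] at hMx
    linarith
  have hxa' : a < x := lt_of_le_of_ne hx.1 hxa.symm
  have hxb' : x < b := lt_of_le_of_ne hx.2 hxb
  obtain ⟨ε, hε, hball⟩ := Metric.eventually_nhds_iff.1 (hD.continuousAt.eventually (lt_mem_nhds hDx))
  obtain ⟨δ, hδ, hδ'⟩ := exists_between (show (0 : ℝ) < min ε (min (x - a) (b - x)) by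
    simp only [lt_min_iff]; exact ⟨hε, by linarith, by linarith⟩)
  simp only [lt_min_iff] at hδ'
  have hconv := h (x - δ) (x + δ) (by linarith) fun y hy => hball (by
    rw [Real.dist_eq, abs_lt]; constructor <;> linarith [hy.1, hy.2])
  have hmid := hconv.2 (Set.left_mem_Icc.2 (by linarith)) (Set.right_mem_Icc.2 (by linarith))
    (show (0 : ℝ) ≤ 1 / 2 by norm_num) (show (0 : ℝ) ≤ 1 / 2 by norm_num) (by norm_num)
  simp only [smul_eq_mul] at hmid
  rw [show (1 / 2 : ℝ) * (x - δ) + 1 / 2 * (x + δ) = x by ring] at hmid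
  have e1 := hmax' (x - δ) ⟨by linarith, by linarith⟩
  have e2 := hmax' (x + δ) ⟨by linarith, by linarith⟩
  simp only [E] at e1 e2
  nlinarith [mul_pos hηpos (mul_pos hδ hδ)]

lemma convexOn_affine (k m a : ℝ) : ConvexOn ℝ Set.univ fun x : ℝ => k + m * (x - a) :=
  ⟨convex_univ, fun x _ y _ s t _ _ hst => le_of_eq (by
    simp only [smul_eq_mul]; linear_combination (m * a - k) * hst)⟩

/-- If `A` dominates every convex minorant of `A + D`, then `A` is affine on every compact interval
on which `D` is positive. -/
lemma eqOn_chord_of_forall_convexOn_le {A D : ℝ → ℝ} (hA : ConvexOn ℝ Set.univ A)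
    (hD : Continuous D) (h0 : ∀ x, 0 ≤ D x)
    (hmax : ∀ v : ℝ → ℝ, ConvexOn ℝ Set.univ v → (∀ x, v x ≤ A x + D x) → ∀ x, v x ≤ A x)
    {a b : ℝ} (hab : a < b) (hpos : ∀ x ∈ Set.Icc a b, 0 < D x) :
    ∀ x ∈ Set.Icc a b, A x = A a + (A b - A a) / (b - a) * (x - a) := by
  have hba : 0 < b - a := sub_pos.2 hab
  have hAc : Continuous A := continuousOn_univ.1 (hA.continuousOn isOpen_univ)
  set m := (A b - A a) / (b - a) with hm
  have hmb : m * (b - a) = A b - A a := by rw [hm]; field_simp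
  let l : ℝ → ℝ := fun x => A a + m * (x - a)
  have hin : ∀ x ∈ Set.Icc a b, A x ≤ l x := by
    intro x hx
    have := hA.2 (Set.mem_univ a) (Set.mem_univ b)
      (div_nonneg (sub_nonneg.2 hx.2) hba.le) (div_nonneg (sub_nonneg.2 hx.1) hba.le)
      (by field_simp; ring)
    simp only [smul_eq_mul] at this
    rw [show (b - x) / (b - a) * a + (x - a) / (b - a) * b = x by field_simp; ring] at this
    refine this.trans (le_of_eq ?_)
    simp only [l, hm]; field_simp; ring
  have hout : ∀ x ∉ Set.Icc a b, l x ≤ A x := by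
    intro x hx
    simp only [Set.mem_Icc, not_and_or, not_le] at hx
    rcases hx with hx | hx
    · have := hA.slope_mono_adjacent (Set.mem_univ x) (Set.mem_univ b) hx hab
      rw [← hm, div_le_iff₀ (by linarith)] at this
      simp only [l]; linarith
    · have := hA.slope_mono_adjacent (Set.mem_univ a) (Set.mem_univ x) hab hx
      rw [← hm, le_div_iff₀ (by linarith)] at this
      simp only [l]; linarith
  obtain ⟨x₀, hx₀, hmin⟩ :=
    isCompact_Icc.exists_isMinOn (Set.nonempty_Icc.2 hab.le) hD.continuousOn
  obtain ⟨x₁, hx₁, hmx⟩ := isCompact_Icc.exists_isMaxOn (Set.nonempty_Icc.2 hab.le)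
    (show Continuous fun x => l x - A x by fun_prop).continuousOn
  have hd := hpos x₀ hx₀
  have hK : 0 ≤ l x₁ - A x₁ := sub_nonneg.2 (hin x₁ hx₁)
  set d := D x₀
  set K := l x₁ - A x₁
  set t := d / (d + K) with ht
  have ht0 : 0 < t := by positivity
  have ht1 : t ≤ 1 := by rw [ht, div_le_one (by positivity)]; linarith
  have htK : t * K ≤ d := by
    rw [ht, div_mul_eq_mul_div, div_le_iff₀ (by positivity)]; nlinarith
  have hv : ConvexOn ℝ Set.univ (A ⊔ ((1 - t) • A + t • l)) :=
    hA.sup ((hA.smul (by linarith)).add ((convexOn_affine _ _ _).smul ht0.le))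
  have hle := hmax _ hv (by
    intro x
    simp only [Pi.sup_apply, Pi.add_apply, Pi.smul_apply, smul_eq_mul]
    refine sup_le (by linarith [h0 x]) ?_
    by_cases hx : x ∈ Set.Icc a b
    · have h1 : d ≤ D x := hmin hx
      have h2 : l x - A x ≤ K := hmx hx
      nlinarith
    · nlinarith [hout x hx, h0 x])
  intro x hx
  refine le_antisymm (hin x hx) ?_
  have := le_sup_right.trans (hle x)
  simp only [Pi.add_apply, Pi.smul_apply, smul_eq_mul] at this
  exact le_of_mul_le_mul_left (by linarith : t * l x ≤ t * A x) ht0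

/-- If `B ≥ ∑ A_j` for convex functions on `ℝ` and if `A_i` dominates every convex minorant of
`B - ∑_{j ≠ i} A_j` for each `i`, then `B = ∑ A_j`. -/
lemma eq_sum_of_forall_convexOn_le {ι : Type*} {s : Finset ι} (hs : s.Nonempty) {A : ι → ℝ → ℝ}
    {B : ℝ → ℝ} (hA : ∀ i ∈ s, ConvexOn ℝ Set.univ (A i)) (hB : ConvexOn ℝ Set.univ B)
    (hle : ∀ x, ∑ i ∈ s, A i x ≤ B x)
    (hmax : ∀ i ∈ s, ∀ v : ℝ → ℝ, ConvexOn ℝ Set.univ v →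
      (∀ x, v x ≤ A i x + (B x - ∑ j ∈ s, A j x)) → ∀ x, v x ≤ A i x) (x : ℝ) :
    B x = ∑ i ∈ s, A i x := by
  have hAc : ∀ i ∈ s, Continuous (A i) := fun i hi =>
    continuousOn_univ.1 ((hA i hi).continuousOn isOpen_univ)
  have hBc : Continuous B := continuousOn_univ.1 (hB.continuousOn isOpen_univ)
  let D : ℝ → ℝ := fun x => B x - ∑ i ∈ s, A i x
  have hD : Continuous D := hBc.sub (continuous_finsetSum _ hAc)
  have h0 : ∀ x, 0 ≤ D x := fun x => sub_nonneg.2 (hle x)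
  have hDconv : ConvexOn ℝ Set.univ D := by
    refine convexOn_univ_of_convexOn_Icc_of_pos hD h0 fun a b hab hpos => ?_
    have key : ∀ x ∈ Set.Icc a b, B x + ((-∑ i ∈ s, A i a) +
        (-∑ i ∈ s, (A i b - A i a) / (b - a)) * (x - a)) = D x := by
      intro x hx
      have : ∑ i ∈ s, A i x = ∑ i ∈ s, (A i a + (A i b - A i a) / (b - a) * (x - a)) :=
        Finset.sum_congr rfl fun i hi =>
          eqOn_chord_of_forall_convexOn_le (hA i hi) hD h0 (hmax i hi) hab hpos x hx
      simp only [D]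
      rw [this, Finset.sum_add_distrib, ← Finset.sum_mul]
      ring
    exact ((hB.add (convexOn_affine _ _ _)).subset (Set.subset_univ _) (convex_Icc a b)).congr key
  obtain ⟨i, hi⟩ := hs
  have := hmax i hi (A i + D) ((hA i hi).add hDconv) (fun _ => le_rfl) x
  have h0x := h0 x
  simp only [Pi.add_apply, D] at this h0x
  linarith

/-- A proper lower semicontinuous convex function on `ℝ` is the supremum of its affine
minorants. -/
lemma le_of_forall_affine_le {f : ℝ → EReal} (hf : f ∈ properLscConvex ℝ) {z T : ℝ}
    (h : ∀ s k : ℝ, (∀ x, ((s * x + k : ℝ) : EReal) ≤ f x) → s * z + k ≤ T) : f z ≤ T := by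
  obtain ⟨⟨hbot, x₀, hx₀⟩, hlsc, hconv⟩ := hf
  let S : Set (ℝ × ℝ) := {p | f p.1 ≤ (p.2 : EReal)}
  have hSc : IsClosed S :=
    hlsc.isClosed_epigraph.preimage
      (f := fun p : ℝ × ℝ => (p.1, (p.2 : EReal)))
      (continuous_fst.prodMk (continuous_coe_real_ereal.comp continuous_snd))
  have hSx : Convex ℝ S := by
    intro p hp q hq a b ha hb hab
    refine (hconv p.1 q.1 a b ha hb hab).trans ?_
    have h1 : (a : EReal) * f p.1 ≤ a * (p.2 : EReal) :=
      mul_le_mul_of_nonneg_left hp (EReal.coe_nonneg.2 ha)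
    have h2 : (b : EReal) * f q.1 ≤ b * (q.2 : EReal) :=
      mul_le_mul_of_nonneg_left hq (EReal.coe_nonneg.2 hb)
    refine (add_le_add h1 h2).trans (le_of_eq ?_)
    simp [← EReal.coe_mul, ← EReal.coe_add]
  have sep : ∀ w t : ℝ, ¬ f w ≤ t → ∃ a b u : ℝ, a * w + b * t < u ∧
      ∀ x y : ℝ, f x ≤ y → u < a * x + b * y := by
    intro w t hwt
    obtain ⟨L, u, hu, hL⟩ := geometric_hahn_banach_point_closed hSx hSc (x := (w, t)) hwt
    have hLe : ∀ x y : ℝ, L (x, y) = L (1, 0) * x + L (0, 1) * y := by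
      intro x y
      have : ((x, y) : ℝ × ℝ) = x • (1, 0) + y • (0, 1) := by simp
      rw [this, map_add, map_smul, map_smul, smul_eq_mul, smul_eq_mul]; ring
    refine ⟨L (1, 0), L (0, 1), u, by rwa [← hLe], fun x y hxy => ?_⟩
    rw [← hLe]; exact hL (x, y) hxy
  have hr₀ : f x₀ = ((f x₀).toReal : EReal) := (EReal.coe_toReal hx₀ (hbot x₀)).symm
  set r₀ := (f x₀).toReal
  have nonneg : ∀ a b u : ℝ, (∀ x y : ℝ, f x ≤ y → u < a * x + b * y) → 0 ≤ b := by
    intro a b u hu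
    by_contra! hb
    have := hu x₀ (max r₀ ((u - a * x₀) / b)) (by
      rw [hr₀]; exact EReal.coe_le_coe_iff.2 (le_max_left _ _))
    have h2 : b * max r₀ ((u - a * x₀) / b) ≤ b * ((u - a * x₀) / b) :=
      mul_le_mul_of_nonpos_left (le_max_right _ _) hb.le
    rw [mul_div_cancel₀ _ hb.ne] at h2
    linarith
  have minor : ∀ a b u : ℝ, 0 < b → (∀ x y : ℝ, f x ≤ y → u < a * x + b * y) →
      ∀ x, (((-a / b) * x + u / b : ℝ) : EReal) ≤ f x := by
    intro a b u hb hu x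
    refine EReal.le_of_forall_lt_iff_le.1 fun y hy => ?_
    have := hu x y hy.le
    rw [EReal.coe_le_coe_iff, show -a / b * x + u / b = (u - a * x) / b by ring, div_le_iff₀ hb]
    linarith
  by_contra hT
  obtain ⟨a₀, b₀, u₀, h₀, h₀'⟩ := sep x₀ (r₀ - 1) (by
    rw [hr₀, EReal.coe_le_coe_iff]; linarith)
  have hb₀ : 0 < b₀ := by
    have := h₀' x₀ r₀ hr₀.le
    nlinarith
  have hmin₀ := minor a₀ b₀ u₀ hb₀ h₀'
  obtain ⟨a, b, u, hu, hu'⟩ := sep z T hT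
  rcases (nonneg a b u hu').lt_or_eq with hb | rfl
  · have := h _ _ (minor a b u hb hu')
    rw [show -a / b * z + u / b = (u - a * z) / b by ring, div_le_iff₀ hb] at this
    linarith
  · have hgap : 0 < u - a * z := by linarith
    obtain ⟨k, hk⟩ := exists_gt (max 0 ((T - (-a₀ / b₀ * z + u₀ / b₀)) / (u - a * z)))
    rw [max_lt_iff, div_lt_iff₀ hgap] at hk
    have := h (-a₀ / b₀ - k * a) (u₀ / b₀ + k * u) (by
      intro x
      rcases eq_or_ne (f x) ⊤ with hx | hx
      · rw [hx]; exact le_top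
      · have h1 := hu' x _ (EReal.coe_toReal hx (hbot x)).ge
        refine le_trans (EReal.coe_le_coe_iff.2 ?_) (hmin₀ x)
        nlinarith [hk.1])
    linarith [hk.2]


lemma two_mul_sum_Ioi_mul {N : ℕ} (x : Fin N → ℝ) :
    2 * ∑ i, ∑ j ∈ Finset.Ioi i, x i * x j = (∑ i, x i) ^ 2 - ∑ i, x i ^ 2 := by
  induction N with
  | zero => simp
  | succ n ih =>
    have := ih fun i => x i.succ
    simp only [Fin.sum_univ_succ, Fin.sum_Ioi_zero, Fin.sum_Ioi_succ, ← Finset.mul_sum] at this ⊢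
    linear_combination this

lemma cost_eq {N : ℕ} (x : Fin N → ℝ) (i : Fin N) :
    cost x = x i * ∑ j ∈ Finset.univ.erase i, x j +
      ((∑ j ∈ Finset.univ.erase i, x j) ^ 2 - ∑ j ∈ Finset.univ.erase i, x j ^ 2) / 2 := by
  have h := two_mul_sum_Ioi_mul x
  rw [← Finset.add_sum_erase _ x (Finset.mem_univ i),
    ← Finset.add_sum_erase _ (fun j => x j ^ 2) (Finset.mem_univ i)] at h
  have hc : cost x = ∑ i, ∑ j ∈ Finset.Ioi i, x i * x j := by
    simp [cost, mul_comm]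
  rw [hc]
  linear_combination h / 2

lemma sum_le_of_forall_sum_le_of_isLUB {ι : Type*} {s : Finset ι} {U : ι → Set ℝ} {A : ι → ℝ}
    {M : ℝ} (hA : ∀ i ∈ s, IsLUB (U i) (A i))
    (h : ∀ y : ι → ℝ, (∀ i ∈ s, y i ∈ U i) → ∑ i ∈ s, y i ≤ M) : ∑ i ∈ s, A i ≤ M := by
  classical
  refine le_of_forall_pos_le_add fun ε hε => ?_
  have : ∀ i, ∃ y, i ∈ s → y ∈ U i ∧ A i - ε / (s.card + 1) < y := by
    intro i
    by_cases hi : i ∈ s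
    · obtain ⟨y, hy, hlt, -⟩ := (hA i hi).exists_between
        (show A i - ε / (s.card + 1) < A i by have : 0 < ε / ((s.card : ℝ) + 1) := by positivity
                                              linarith)
      exact ⟨y, fun _ => ⟨hy, hlt⟩⟩
    · exact ⟨0, fun h => absurd h hi⟩
  choose y hy using this
  have h1 := h y fun i hi => (hy i hi).1
  have h2 : ∑ i ∈ s, (A i - ε / (s.card + 1)) ≤ ∑ i ∈ s, y i :=
    Finset.sum_le_sum fun i hi => (hy i hi).2.le
  rw [Finset.sum_sub_distrib, Finset.sum_const, nsmul_eq_mul] at h2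
  have h3 : (s.card : ℝ) * (ε / (s.card + 1)) ≤ ε := by
    rw [← mul_div_assoc, div_le_iff₀ (by positivity)]; nlinarith
  linarith

/-- The values `p x - f(x) - x² / 2`, whose supremum is the conjugate of `f + |·|² / 2` at `p`. -/
def conjValues (f : ℝ → EReal) (p : ℝ) : Set ℝ :=
  {y | ∃ x, f x ≠ ⊤ ∧ y = p * x - (f x).toReal - x ^ 2 / 2}

/-- The values `f(z) + (p - z)² / 2`, whose infimum is the Moreau envelope of `f` at `p`. -/
def envValues (f : ℝ → EReal) (p : ℝ) : Set ℝ :=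
  {y | ∃ z, f z ≠ ⊤ ∧ y = (f z).toReal + (p - z) ^ 2 / 2}

lemma IsProper.conjValues_nonempty {f : ℝ → EReal} (hf : IsProper f) (p : ℝ) :
    (conjValues f p).Nonempty :=
  let ⟨x, hx⟩ := hf.2
  ⟨_, x, hx, rfl⟩

lemma IsProper.envValues_nonempty {f : ℝ → EReal} (hf : IsProper f) (p : ℝ) :
    (envValues f p).Nonempty :=
  let ⟨x, hx⟩ := hf.2
  ⟨_, x, hx, rfl⟩

lemma IsProper.convexOn_sSup_conjValues {f : ℝ → EReal} (hf : IsProper f)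
    (hb : ∀ p, BddAbove (conjValues f p)) :
    ConvexOn ℝ Set.univ fun p => sSup (conjValues f p) := by
  refine ⟨convex_univ, fun p _ q _ a b ha hb' hab => csSup_le (hf.conjValues_nonempty _) ?_⟩
  rintro _ ⟨x, hx, rfl⟩
  have h1 := mul_le_mul_of_nonneg_left (le_csSup (hb p) ⟨x, hx, rfl⟩) ha
  have h2 := mul_le_mul_of_nonneg_left (le_csSup (hb q) ⟨x, hx, rfl⟩) hb'
  simp only [smul_eq_mul]
  refine le_trans (le_of_eq ?_) (add_le_add h1 h2)
  linear_combination ((f x).toReal + x ^ 2 / 2) * hab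

lemma convexOn_sInf_envValues {f : ℝ → EReal} (hf : f ∈ properLscConvex ℝ)
    (hb : ∀ p, BddBelow (envValues f p)) :
    ConvexOn ℝ Set.univ fun p => sInf (envValues f p) := by
  obtain ⟨hp, -, hconv⟩ := hf
  refine ⟨convex_univ, fun p _ q _ a b ha hb' hab => le_of_forall_pos_le_add fun ε hε => ?_⟩
  obtain ⟨_, ⟨z, hz, rfl⟩, hzlt⟩ := exists_lt_of_csInf_lt (hp.envValues_nonempty p)
    (lt_add_of_pos_right _ hε)
  obtain ⟨_, ⟨w, hw, rfl⟩, hwlt⟩ := exists_lt_of_csInf_lt (hp.envValues_nonempty q)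
    (lt_add_of_pos_right _ hε)
  have hle := hconv z w a b ha hb' hab
  rw [← EReal.coe_toReal hz (hp.1 z), ← EReal.coe_toReal hw (hp.1 w), ← EReal.coe_mul,
    ← EReal.coe_mul, ← EReal.coe_add] at hle
  have htop : f (a • z + b • w) ≠ ⊤ := ne_top_of_le_ne_top (EReal.coe_ne_top _) hle
  rw [← EReal.coe_toReal htop (hp.1 _), EReal.coe_le_coe_iff] at hle
  refine (csInf_le (hb _) ⟨_, htop, rfl⟩).trans ?_
  simp only [smul_eq_mul] at hle ⊢
  have h1 := mul_le_mul_of_nonneg_left hzlt.le ha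
  have h2 := mul_le_mul_of_nonneg_left hwlt.le hb'
  have hq : (a * p + b * q - (a * z + b * w)) ^ 2 ≤ a * (p - z) ^ 2 + b * (q - w) ^ 2 := by
    obtain rfl : a = 1 - b := by linarith
    nlinarith [mul_nonneg (mul_nonneg ha hb') (sq_nonneg ((p - z) - (q - w)))]
  have h3 : a * ε + b * ε = ε := by rw [← add_mul, hab, one_mul]
  linarith

section Conjugate

variable {N : ℕ} {f : Fin N → ℝ → EReal}

lemma coe_cost_sub_sum {i : Fin N} {x : Fin N → ℝ} (hf : ∀ j, IsProper (f j))
    (hx : ∀ j, j ≠ i → f j (x j) ≠ ⊤) :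
    (cost x : EReal) - ∑ j ∈ Finset.univ.erase i, f j (x j) =
      ((cost x - ∑ j ∈ Finset.univ.erase i, (f j (x j)).toReal : ℝ) : EReal) := by
  have : ∑ j ∈ Finset.univ.erase i, f j (x j) =
      ((∑ j ∈ Finset.univ.erase i, (f j (x j)).toReal : ℝ) : EReal) := by
    rw [show ∀ (s : Finset (Fin N)) (g : Fin N → ℝ), ((∑ j ∈ s, g j : ℝ) : EReal) = ∑ j ∈ s, (g j : EReal)
      from fun s g => map_sum (⟨⟨Real.toEReal, rfl⟩, EReal.coe_add⟩ : ℝ →+ EReal) g s]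
    exact Finset.sum_congr rfl fun j hj =>
      (EReal.coe_toReal (hx j (Finset.ne_of_mem_erase hj)) ((hf j).1 _)).symm
  rw [this, EReal.coe_sub]

lemma cConj_le_coe_iff (hf : ∀ j, IsProper (f j)) {i : Fin N} {z T : ℝ} :
    cConj f i z ≤ T ↔ ∀ x : Fin N → ℝ, x i = z → (∀ j, j ≠ i → f j (x j) ≠ ⊤) →
      cost x - ∑ j ∈ Finset.univ.erase i, (f j (x j)).toReal ≤ T := by
  rw [cConj, iSup₂_le_iff]
  refine forall_congr' fun x => forall_congr' fun hx => ?_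
  by_cases h : ∀ j, j ≠ i → f j (x j) ≠ ⊤
  · rw [coe_cost_sub_sum hf h, EReal.coe_le_coe_iff]
    exact ⟨fun h' _ => h', fun h' => h' h⟩
  · refine ⟨fun _ h' => absurd h' h, fun _ => ?_⟩
    push Not at h
    obtain ⟨j, hj, hjt⟩ := h
    have : ∑ j ∈ Finset.univ.erase i, f j (x j) = ⊤ := by
      rw [← Finset.add_sum_erase _ _ (Finset.mem_erase.2 ⟨hj, Finset.mem_univ j⟩), hjt]
      refine EReal.top_add_of_ne_bot ?_
      exact Finset.sum_induction _ (· ≠ ⊥) (fun a b ha hb => by simp [ha, hb]) (by simp)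
        fun k _ => (hf k).1 _
    rw [this]
    simp

lemma sum_conj_le_of_cConj_le (hf : ∀ j, IsProper (f j)) {i : Fin N} {z T p : ℝ}
    (hT : cConj f i z ≤ T) (y : Fin N → ℝ)
    (hy : ∀ j ∈ Finset.univ.erase i, y j ∈ conjValues (f j) p) :
    ∑ j ∈ Finset.univ.erase i, y j ≤ T + (p - z) ^ 2 / 2 := by
  have : ∀ j, ∃ x, j ≠ i → f j x ≠ ⊤ ∧ y j = p * x - (f j x).toReal - x ^ 2 / 2 := by
    intro j
    by_cases hj : j = i
    · exact ⟨0, fun h => absurd hj h⟩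
    · obtain ⟨x, hx⟩ := hy j (Finset.mem_erase.2 ⟨hj, Finset.mem_univ j⟩)
      exact ⟨x, fun _ => hx⟩
  choose x hx using this
  let w := Function.update x i z
  have hw : ∀ j, j ≠ i → w j = x j := fun j hj => Function.update_of_ne hj _ _
  have hwi : w i = z := Function.update_self _ _ _
  have hc := (cConj_le_coe_iff hf).1 hT w hwi fun j hj => by rw [hw j hj]; exact (hx j hj).1
  have hs : ∑ j ∈ Finset.univ.erase i, y j = p * ∑ j ∈ Finset.univ.erase i, w j -
      ∑ j ∈ Finset.univ.erase i, (f j (w j)).toReal -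
      (∑ j ∈ Finset.univ.erase i, w j ^ 2) / 2 := by
    rw [Finset.mul_sum, Finset.sum_div, ← Finset.sum_sub_distrib, ← Finset.sum_sub_distrib]
    exact Finset.sum_congr rfl fun j hj => by
      rw [hw j (Finset.ne_of_mem_erase hj)]; exact (hx j (Finset.ne_of_mem_erase hj)).2
  rw [cost_eq w i, hwi] at hc
  nlinarith [sq_nonneg (z + ∑ j ∈ Finset.univ.erase i, w j - p)]

/-- If `f_i` is the `c`-conjugate of the other functions, then the conjugate `A_i` of
`f_i + |·|² / 2` dominates every convex minorant of the Moreau envelope of `f_o` minus the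
corresponding conjugates of the remaining functions. -/
lemma le_sSup_conjValues (hf : ∀ j, IsProper (f j)) {o i : Fin N} (hi : i ≠ o)
    (hconj : ∀ z, f i z = cConj f i z)
    (hA : ∀ j ≠ o, ∀ p, BddAbove (conjValues (f j) p)) (hB : ∀ p, BddBelow (envValues (f o) p))
    {v : ℝ → ℝ} (hv : ConvexOn ℝ Set.univ v)
    (hle : ∀ p, v p ≤ sSup (conjValues (f i) p) + (sInf (envValues (f o) p) -
      ∑ j ∈ Finset.univ.erase o, sSup (conjValues (f j) p))) (p : ℝ) :
    v p ≤ sSup (conjValues (f i) p) := by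
  refine le_of_forall_lt fun t ht => ?_
  obtain ⟨t', htt', ht'⟩ := exists_between ht
  refine htt'.trans_le ?_
  obtain ⟨m, k, hmk, hp⟩ := hv.exists_affine_le_of_lt_real (Set.mem_univ p) ht' isClosed_univ
    (hv.continuousOn isOpen_univ).lowerSemicontinuousOn
  have hbound : f i m ≤ ((-k - m ^ 2 / 2 : ℝ) : EReal) := by
    rw [hconj m, cConj_le_coe_iff hf]
    intro x hxi hx
    set S := ∑ j ∈ Finset.univ.erase o, x j with hS
    set P := x o + S with hP
    have h1 := (hmk P (Set.mem_univ _)).trans (hle P)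
    have h2 := csInf_le (hB P) ⟨x o, hx o hi.symm, rfl⟩
    have hio : i ∈ Finset.univ.erase o := Finset.mem_erase.2 ⟨hi, Finset.mem_univ _⟩
    have hoi : o ∈ Finset.univ.erase i := Finset.mem_erase.2 ⟨hi.symm, Finset.mem_univ _⟩
    rw [← Finset.add_sum_erase _ _ hio] at h1
    have h3 : ∑ j ∈ (Finset.univ.erase o).erase i, (P * x j - (f j (x j)).toReal - x j ^ 2 / 2) ≤
        ∑ j ∈ (Finset.univ.erase o).erase i, sSup (conjValues (f j) P) :=
      Finset.sum_le_sum fun j hj => le_csSup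
        (hA j (Finset.ne_of_mem_erase (Finset.mem_of_mem_erase hj)) P)
        ⟨x j, hx j (Finset.ne_of_mem_erase hj), rfl⟩
    rw [Finset.sum_sub_distrib, Finset.sum_sub_distrib, ← Finset.mul_sum, ← Finset.sum_div] at h3
    have e1 : S = m + ∑ j ∈ (Finset.univ.erase o).erase i, x j := by
      rw [hS, ← Finset.add_sum_erase _ _ hio, hxi]
    have e2 : ∑ j ∈ Finset.univ.erase o, x j ^ 2 =
        m ^ 2 + ∑ j ∈ (Finset.univ.erase o).erase i, x j ^ 2 := by
      rw [← Finset.add_sum_erase _ _ hio, hxi]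
    rw [← Finset.add_sum_erase _ _ hoi, Finset.erase_right_comm, cost_eq x o, e2, ← hS]
    have e3 : ∑ j ∈ (Finset.univ.erase o).erase i, x j = S - m := by linarith
    rw [e3] at h3
    have e4 : P - x o = S := by rw [hP]; ring
    rw [e4] at h2
    have e5 : m * P + P * (S - m) = x o * S + S ^ 2 := by rw [hP]; ring
    linarith
  have htop : f i m ≠ ⊤ := ne_top_of_le_ne_top (EReal.coe_ne_top _) hbound
  rw [← EReal.coe_toReal htop ((hf i).1 _), EReal.coe_le_coe_iff] at hbound
  have := le_csSup (hA i hi p) ⟨m, htop, rfl⟩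
  linarith

lemma bddBelow_envValues (hf : ∀ j, IsProper (f j)) {o : Fin N} (hc : ∀ z, cConj f o z ≤ f o z)
    (p : ℝ) : BddBelow (envValues (f o) p) := by
  choose y hy using fun j => (hf j).conjValues_nonempty p
  refine ⟨∑ j ∈ Finset.univ.erase o, y j, ?_⟩
  rintro _ ⟨z, hz, rfl⟩
  exact sum_conj_le_of_cConj_le hf
    ((hc z).trans (EReal.coe_toReal hz ((hf o).1 z)).ge) y fun j _ => hy j

lemma bddAbove_conjValues (hf : ∀ j, IsProper (f j)) {o i : Fin N} (hi : i ≠ o)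
    (hc : ∀ z, cConj f o z ≤ f o z) (p : ℝ) : BddAbove (conjValues (f i) p) := by
  obtain ⟨z, hz⟩ := (hf o).2
  choose y hy using fun j => (hf j).conjValues_nonempty p
  refine ⟨(f o z).toReal + (p - z) ^ 2 / 2 - ∑ j ∈ (Finset.univ.erase o).erase i, y j, ?_⟩
  intro a ha
  have := sum_conj_le_of_cConj_le hf ((hc z).trans (EReal.coe_toReal hz ((hf o).1 z)).ge)
    (Function.update y i a) (fun j _ => by
      rcases eq_or_ne j i with rfl | hj
      · simpa using ha
      · simpa [hj] using hy j)
  rw [← Finset.add_sum_erase _ _ (Finset.mem_erase.2 ⟨hi, Finset.mem_univ i⟩),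
    Function.update_self] at this
  have e : ∑ j ∈ (Finset.univ.erase o).erase i, Function.update y i a j =
      ∑ j ∈ (Finset.univ.erase o).erase i, y j :=
    Finset.sum_congr rfl fun j hj => Function.update_of_ne (Finset.ne_of_mem_erase hj) _ _
  linarith

lemma sum_sSup_conjValues_le (hf : ∀ j, IsProper (f j)) {o : Fin N}
    (hA : ∀ j ≠ o, ∀ p, BddAbove (conjValues (f j) p)) {z T : ℝ} (hT : cConj f o z ≤ T) (p : ℝ) :
    ∑ j ∈ Finset.univ.erase o, sSup (conjValues (f j) p) ≤ T + (p - z) ^ 2 / 2 :=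
  sum_le_of_forall_sum_le_of_isLUB
    (fun j hj => isLUB_csSup ((hf j).conjValues_nonempty p) (hA j (Finset.ne_of_mem_erase hj) p))
    (sum_conj_le_of_cConj_le hf hT)

/-- The inequality `c ≤ ∑ f_j` is symmetric in the indices. -/
lemma cConj_le_of_cConj_le (hf : ∀ j, IsProper (f j)) {o i : Fin N}
    (hc : ∀ z, cConj f i z ≤ f i z) (z : ℝ) : cConj f o z ≤ f o z := by
  rcases eq_or_ne (f o z) ⊤ with hz | hz
  · rw [hz]; exact le_top
  rw [← EReal.coe_toReal hz ((hf o).1 z), cConj_le_coe_iff hf]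
  intro x hxo hx
  have hx' : ∀ j, f j (x j) ≠ ⊤ := fun j => by
    rcases eq_or_ne j o with rfl | hj
    · rwa [hxo]
    · exact hx j hj
  have := (cConj_le_coe_iff hf).1 ((hc (x i)).trans (EReal.coe_toReal (hx' i) ((hf i).1 _)).ge) x
    rfl fun j _ => hx' j
  have h1 := Finset.add_sum_erase Finset.univ (fun j => (f j (x j)).toReal) (Finset.mem_univ i)
  have h2 := Finset.add_sum_erase Finset.univ (fun j => (f j (x j)).toReal) (Finset.mem_univ o)
  simp only [hxo] at h2
  linarith

/-- If `f_i` is the `c`-conjugate of the other functions for every `i ≠ o`, then so is `f_o`. -/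
theorem eq_cConj_of_forall_ne (hf : ∀ j, f j ∈ properLscConvex ℝ) {o i₀ : Fin N} (hi₀ : i₀ ≠ o)
    (h : ∀ i ≠ o, ∀ z, f i z = cConj f i z) (z : ℝ) : f o z = cConj f o z := by
  have hp : ∀ j, IsProper (f j) := fun j => (hf j).1
  have hc : ∀ z, cConj f o z ≤ f o z := cConj_le_of_cConj_le hp fun z => (h i₀ hi₀ z).ge
  have hA : ∀ j ≠ o, ∀ p, BddAbove (conjValues (f j) p) := fun j hj => bddAbove_conjValues hp hj hc
  have hB : ∀ p, BddBelow (envValues (f o) p) := bddBelow_envValues hp hc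
  have heq : ∀ p, sInf (envValues (f o) p) =
      ∑ j ∈ Finset.univ.erase o, sSup (conjValues (f j) p) := by
    refine eq_sum_of_forall_convexOn_le ⟨i₀, Finset.mem_erase.2 ⟨hi₀, Finset.mem_univ _⟩⟩
      (A := fun j p => sSup (conjValues (f j) p)) (B := fun p => sInf (envValues (f o) p))
      (fun j hj => (hp j).convexOn_sSup_conjValues (hA j (Finset.ne_of_mem_erase hj)))
      (convexOn_sInf_envValues (hf o) hB)
      (fun p => le_csInf ((hp o).envValues_nonempty p) ?_)
      fun i hi v hv hle => le_sSup_conjValues hp (Finset.ne_of_mem_erase hi)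
        (h i (Finset.ne_of_mem_erase hi)) hA hB hv hle
    rintro _ ⟨w, hw, rfl⟩
    exact sum_sSup_conjValues_le hp hA ((hc w).trans (EReal.coe_toReal hw ((hp o).1 w)).ge) p
  refine le_antisymm (EReal.le_of_forall_lt_iff_le.1 fun T hT => ?_) (hc z)
  refine le_of_forall_affine_le (hf o) fun s k hsk => ?_
  have h1 := sum_sSup_conjValues_le hp hA hT.le (z + s)
  rw [← heq] at h1
  have h2 : s * (z + s) + k - s ^ 2 / 2 ≤ sInf (envValues (f o) (z + s)) := by
    refine le_csInf ((hp o).envValues_nonempty _) ?_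
    rintro _ ⟨w, hw, rfl⟩
    have := hsk w
    rw [← EReal.coe_toReal hw ((hp o).1 w), EReal.coe_le_coe_iff] at this
    nlinarith [sq_nonneg (z + s - w - s)]
  nlinarith

end Conjugate

theorem mainTheorem3 : IsCyclicallyInvolutive (properLscConvex ℝ) := by
  intro N hN f hf h
  refine ⟨fun i => (hf i).1, fun i => ?_⟩
  by_cases hi : (i : ℕ) = 0
  · have hne : (⟨1, hN⟩ : Fin N) ≠ i := fun h => by simp [← h] at hi
    exact eq_cConj_of_forall_ne hf hne fun j hj => h j fun h0 => hj (Fin.ext (h0.trans hi.symm))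
  · exact h i hi
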